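/- Let $K$ be a field and let $R=\bigoplus_{i\ge 0}R_i$ be a positively graded $K$-algebra, not necessarily commutative, which is connected ($R_0=K$), generated in degree $1$ (that is, generated by $R_1$ as a $K$-algebra), right noetherian and right fully bounded (for every prime ideal $P$ of $R$, each essential right ideal of $R/P$ contains a two-sided ideal that is essential as a right ideal). Let $R_+=\bigoplus_{i\ge 1}R_i$. Let $Gr(R)$ be the category of $\mathbb{Z}$-graded right $R$-modules with degree-preserving $R$-linear maps. An element $x$ of a graded module is torsion if there is $N\ge 0$ with $xR_j=0$ for all $j>N$, and a module is torsion if all its elements are. Let $Tails(R)=Gr(R)/Tors(R)$ be the quotient category by the torsion modules, i.e. the localization of $Gr(R)$ at the morphisms whose kernel and cokernel are torsion, and let $\pi\colon Gr(R)\to Tails(R)$ be the projection functor. For an indecomposable injective object $E$ of $Gr(R)$, its assassinator $Ass(E)$ is the unique prime ideal of $R$ that is maximal among the annihilators of the nonzero graded submodules of $E$. The torsion class cogenerated by $\pi E$ is $$\mathcal{T}_{\pi E}=\{X\in Tails(R) : \mathrm{Hom}_{Tails(R)}(X,\pi E)=0\}.$$ Then the intersection of the classes $\mathcal{T}_{\pi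 E}$, with $E$ running over all indecomposable injective objects of $Gr(R)$ (in particular, over all graded shifts of each of them) such that $Ass(E)\neq R_+$, is zero: an object $X$ of $Tails(R)$ lies in $\mathcal{T}_{\pi E}$ for all these $E$ if and only if $X$ is a zero object. -/

import Mathlib

open CategoryTheory CategoryTheory.Limits MulOpposite

universe u v

/-! ### Fully bounded rings -/

/-- A two-sided ideal `P` of a (not necessarily commutative) ring is prime if it is proper and
`a R b ⊆ P` implies `a ∈ P` or `b ∈ P`. -/
def TwoSidedIdeal.IsPrimeIdeal {R : Type u} [Ring R] (P : TwoSidedIdeal R) : Prop :=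
  P ≠ ⊤ ∧ ∀ a b : R, (∀ r : R, a * r * b ∈ P) → a ∈ P ∨ b ∈ P

/-- A right ideal of `S`, i.e. a left ideal of `Sᵐᵒᵖ`, is essential if it meets every nonzero right
ideal nontrivially. -/
def IsEssentialRightIdeal {S : Type u} [Ring S] (I : Ideal Sᵐᵒᵖ) : Prop :=
  ∀ J : Ideal Sᵐᵒᵖ, J ≠ ⊥ → I ⊓ J ≠ ⊥

/-- A ring is right bounded if every essential right ideal contains a two-sided ideal which is
essential as a right ideal. (For prime rings this amounts to containing a nonzero two-sided
ideal.) -/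
def IsRightBounded (S : Type u) [Ring S] : Prop :=
  ∀ I : Ideal Sᵐᵒᵖ, IsEssentialRightIdeal I →
    ∃ J : TwoSidedIdeal S, TwoSidedIdeal.asIdealOpposite J ≤ I ∧
      IsEssentialRightIdeal (TwoSidedIdeal.asIdealOpposite J)

/-- A ring is right fully bounded if all its prime factor rings are right bounded. -/
def IsRightFullyBounded (R : Type u) [Ring R] : Prop :=
  ∀ P : TwoSidedIdeal R, P.IsPrimeIdeal → IsRightBounded P.ringCon.Quotient

/-! ### Connected graded algebras -/

section GradedAlgebra

variable {K : Type v} {R : Type u} [Field K] [Ring R] [Algebra K R]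

/-- The algebra `R = ⨁ 𝒜 i` is connected: the structure map is a bijection from `K` onto `𝒜 0`. -/
def IsConnectedGraded (𝒜 : ℕ → Submodule K R) : Prop :=
  Function.Injective (algebraMap K R) ∧ Set.range (algebraMap K R) = (𝒜 0 : Set R)

/-- The `K`-algebra `R = ⨁ 𝒜 i` is generated in degree one. -/
def IsGeneratedInDegreeOne (𝒜 : ℕ → Submodule K R) : Prop :=
  Algebra.adjoin K (𝒜 1 : Set R) = ⊤

/-- The irrelevant ideal `R₊ = ⨁_{i ≥ 1} 𝒜 i`, as a two-sided ideal: the elements with vanishing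
component of degree zero. -/
def irrelevantIdeal (𝒜 : ℕ → Submodule K R) [GradedAlgebra 𝒜] : TwoSidedIdeal R :=
  TwoSidedIdeal.ker (GradedRing.projZeroRingHom 𝒜)

end GradedAlgebra

/-! ### The category `Gr(R)` of graded right modules -/

/-- A `ℤ`-graded right module over the graded algebra `R = ⨁ 𝒜 i`. -/
structure GrMod {K : Type v} {R : Type u} [Field K] [Ring R] [Algebra K R]
    (𝒜 : ℕ → Submodule K R) where
  /-- the underlying type -/
  carrier : Type u
  [addCommGroup : AddCommGroup carrier]
  /-- the right action of `R` -/
  [module : Module Rᵐᵒᵖ carrier]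
  /-- the homogeneous components -/
  deg : ℤ → AddSubgroup carrier
  /-- the module is the internal direct sum of its homogeneous components -/
  [decomposition : DirectSum.Decomposition deg]
  smul_mem' : ∀ (i : ℕ) (n : ℤ) (r : R) (x : carrier),
    r ∈ 𝒜 i → x ∈ deg n → op r • x ∈ deg (n + i)

namespace GrMod

variable {K : Type v} {R : Type u} [Field K] [Ring R] [Algebra K R] {𝒜 : ℕ → Submodule K R}

instance : CoeSort (GrMod 𝒜) (Type u) := ⟨GrMod.carrier⟩

attribute [instance] GrMod.addCommGroup GrMod.module GrMod.decomposition

/-- Morphisms of graded modules: `R`-linear maps preserving degrees. -/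
@[ext]
structure Hom (M N : GrMod 𝒜) where
  /-- the underlying linear map -/
  hom : M →ₗ[Rᵐᵒᵖ] N
  map_deg : ∀ (n : ℤ) (x : M), x ∈ M.deg n → hom x ∈ N.deg n

instance : Category (GrMod 𝒜) where
  Hom M N := Hom M N
  id M := ⟨LinearMap.id, fun _ _ h => h⟩
  comp f g := ⟨g.hom ∘ₗ f.hom, fun n x h => g.map_deg n _ (f.map_deg n x h)⟩

@[ext]
lemma hom_ext {M N : GrMod 𝒜} {f g : M ⟶ N} (h : f.hom = g.hom) : f = g := Hom.ext h

@[simp] lemma id_hom (M : GrMod 𝒜) : Hom.hom (𝟙 M) = LinearMap.id := rfl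

@[simp] lemma comp_hom {M N L : GrMod 𝒜} (f : M ⟶ N) (g : N ⟶ L) :
    (f ≫ g).hom = g.hom ∘ₗ f.hom := rfl

instance (M N : GrMod 𝒜) : Zero (M ⟶ N) := ⟨⟨0, fun n _ _ => (N.deg n).zero_mem⟩⟩

instance (M N : GrMod 𝒜) : Add (M ⟶ N) :=
  ⟨fun f g => ⟨f.hom + g.hom,
    fun n x h => (N.deg n).add_mem (f.map_deg n x h) (g.map_deg n x h)⟩⟩

instance (M N : GrMod 𝒜) : Neg (M ⟶ N) :=
  ⟨fun f => ⟨-f.hom, fun n x h => (N.deg n).neg_mem (f.map_deg n x h)⟩⟩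

@[simp] lemma zero_hom (M N : GrMod 𝒜) : Hom.hom (0 : M ⟶ N) = 0 := rfl

@[simp] lemma add_hom {M N : GrMod 𝒜} (f g : M ⟶ N) : Hom.hom (f + g) = f.hom + g.hom := rfl

@[simp] lemma neg_hom {M N : GrMod 𝒜} (f : M ⟶ N) : Hom.hom (-f) = -f.hom := rfl

instance (M N : GrMod 𝒜) : AddCommGroup (M ⟶ N) where
  add_assoc f g h := by ext1; simp [add_assoc]
  zero_add f := by ext1; simp
  add_zero f := by ext1; simp
  add_comm f g := by ext1; simp [add_comm]
  neg_add_cancel f := by ext1; simp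
  nsmul := nsmulRec
  zsmul := zsmulRec

instance : Preadditive (GrMod 𝒜) where
  add_comp _ _ _ f f' g := by ext1; simp [LinearMap.comp_add]
  comp_add _ _ _ f g g' := by ext1; simp [LinearMap.add_comp]

/-- The direct sum of two graded modules. -/
noncomputable def prod (M N : GrMod 𝒜) : GrMod 𝒜 where
  carrier := M × N
  deg n := (M.deg n).prod (N.deg n)
  decomposition := DirectSum.Decomposition.ofAddHom _
    (AddMonoidHom.coprod
      ((DirectSum.map fun n : ℤ =>
        ((AddMonoidHom.inl M N).comp (M.deg n).subtype).codRestrict ((M.deg n).prod (N.deg n))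
          fun x => ⟨x.2, (N.deg n).zero_mem⟩).comp
        (DirectSum.decomposeAddEquiv M.deg).toAddMonoidHom)
      ((DirectSum.map fun n : ℤ =>
        ((AddMonoidHom.inr M N).comp (N.deg n).subtype).codRestrict ((M.deg n).prod (N.deg n))
          fun x => ⟨(M.deg n).zero_mem, x.2⟩).comp
        (DirectSum.decomposeAddEquiv N.deg).toAddMonoidHom))
    (by
      have hM : ∀ d : DirectSum ℤ fun n => M.deg n,
          DirectSum.coeAddMonoidHom (fun n => (M.deg n).prod (N.deg n)) (DirectSum.map (fun n : ℤ =>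
            ((AddMonoidHom.inl M N).comp (M.deg n).subtype).codRestrict ((M.deg n).prod (N.deg n))
              fun x => ⟨x.2, (N.deg n).zero_mem⟩) d) =
          (DirectSum.coeAddMonoidHom M.deg d, 0) := by
        intro d
        induction d using DirectSum.induction_on with
        | zero => simp only [map_zero]; rfl
        | of i x => simp only [DirectSum.map_of, DirectSum.coeAddMonoidHom_of]; rfl
        | add x y hx hy => simp [map_add, hx, hy]
      have hN : ∀ d : DirectSum ℤ fun n => N.deg n,
          DirectSum.coeAddMonoidHom (fun n => (M.deg n).prod (N.deg n)) (DirectSum.map (fun n : ℤ =>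
            ((AddMonoidHom.inr M N).comp (N.deg n).subtype).codRestrict ((M.deg n).prod (N.deg n))
              fun x => ⟨(M.deg n).zero_mem, x.2⟩) d) =
          (0, DirectSum.coeAddMonoidHom N.deg d) := by
        intro d
        induction d using DirectSum.induction_on with
        | zero => simp only [map_zero]; rfl
        | of i x => simp only [DirectSum.map_of, DirectSum.coeAddMonoidHom_of]; rfl
        | add x y hx hy => simp [map_add, hx, hy]
      ext1 x
      simp only [AddMonoidHom.comp_apply, AddMonoidHom.coprod_apply, map_add, hM, hN,
        AddMonoidHom.id_apply]
      refine Prod.ext ?_ ?_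
      · simpa using DirectSum.Decomposition.left_inv (ℳ := M.deg) x.1
      · simpa using DirectSum.Decomposition.left_inv (ℳ := N.deg) x.2)
    (by
      ext n x : 2
      obtain ⟨⟨a, b⟩, ha, hb⟩ := x
      simp only [AddMonoidHom.comp_apply, AddMonoidHom.coprod_apply, AddMonoidHom.id_apply,
        DirectSum.coeAddMonoidHom_of]
      have h1 : DirectSum.decomposeAddEquiv M.deg a = DirectSum.of (fun n => M.deg n) n ⟨a, ha⟩ :=
        DirectSum.decompose_of_mem M.deg ha
      have h2 : DirectSum.decomposeAddEquiv N.deg b = DirectSum.of (fun n => N.deg n) n ⟨b, hb⟩ :=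
        DirectSum.decompose_of_mem N.deg hb
      simp only [AddEquiv.toAddMonoidHom_eq_coe, AddMonoidHom.coe_coe, h1, h2, DirectSum.map_of,
        ← map_add]
      congr 1
      exact Subtype.ext (Prod.ext (add_zero a) (zero_add b)))
  smul_mem' i n r x hr hx := ⟨M.smul_mem' i n r x.1 hr hx.1, N.smul_mem' i n r x.2 hr hx.2⟩

/-- The direct sum of two graded modules is a biproduct in the category of graded modules. -/
noncomputable def prodBicone (M N : GrMod 𝒜) : BinaryBicone M N where
  pt := prod M N
  fst := ⟨LinearMap.fst _ _ _, fun _ _ h => h.1⟩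
  snd := ⟨LinearMap.snd _ _ _, fun _ _ h => h.2⟩
  inl := ⟨LinearMap.inl _ _ _, fun n _ h => ⟨h, (N.deg n).zero_mem⟩⟩
  inr := ⟨LinearMap.inr _ _ _, fun n _ h => ⟨(M.deg n).zero_mem, h⟩⟩
  inl_fst := by ext1; rfl
  inl_snd := by ext1; rfl
  inr_fst := by ext1; rfl
  inr_snd := by ext1; rfl

instance : HasBinaryBiproducts (GrMod 𝒜) where
  has_binary_biproduct M N := hasBinaryBiproduct_of_total (prodBicone M N) (by
    ext1
    refine LinearMap.ext fun x => ?_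
    exact Prod.ext (add_zero x.1) (zero_add x.2))

/-! ### Assassinators -/

/-- The annihilator in `R` of a submodule of a right module, a two-sided ideal of `R`. -/
def annihilator {M : GrMod 𝒜} (N : Submodule Rᵐᵒᵖ M) : TwoSidedIdeal R :=
  TwoSidedIdeal.mk' {r : R | ∀ x ∈ N, op r • x = 0}
    (fun x _ => by simp)
    (fun ha hb x hx => by simp [add_smul, ha x hx, hb x hx])
    (fun ha x hx => by simp [neg_smul, ha x hx])
    (fun {a b} hb x hx => by
      rw [op_mul, mul_smul]; exact hb _ (N.smul_mem _ hx))
    (fun {a b} ha x hx => by rw [op_mul, mul_smul, ha x hx, smul_zero])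

/-- `P` is the assassinator ideal of the graded module `E`: it is a prime ideal which is maximal
among the annihilators of the nonzero graded submodules of `E`. (For an indecomposable injective
object over a right noetherian algebra there is exactly one such `P`.) -/
def IsAssassinator (E : GrMod 𝒜) (P : TwoSidedIdeal R) : Prop :=
  P.IsPrimeIdeal ∧
    Maximal (fun J => ∃ N : Submodule Rᵐᵒᵖ E, N.IsHomogeneous E.deg ∧ N ≠ ⊥ ∧ J = annihilator N) P

/-! ### The quotient category `Tails(R) = Gr(R)/Tors(R)` -/

/-- Modulo the submodule `L`, the element `x` is torsion: `x R_j ⊆ L` for all large `j`. -/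
def IsTorsionModulo {M : GrMod 𝒜} (L : Submodule Rᵐᵒᵖ M) (x : M) : Prop :=
  ∃ N : ℕ, ∀ j : ℕ, N < j → ∀ r ∈ 𝒜 j, op r • x ∈ L

variable (𝒜) in
/-- The morphisms of graded modules whose kernel and cokernel are torsion modules, where a module
is torsion if for each of its elements `x` one has `x R_j = 0` for all large `j`. -/
def isoModTorsion : MorphismProperty (GrMod 𝒜) := fun M _ f =>
  (∀ x ∈ LinearMap.ker f.hom, IsTorsionModulo (⊥ : Submodule Rᵐᵒᵖ M) x) ∧
    ∀ y, IsTorsionModulo (LinearMap.range f.hom) y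

end GrMod

section Tails

variable {K : Type v} {R : Type u} [Field K] [Ring R] [Algebra K R] (𝒜 : ℕ → Submodule K R)

/-- The quotient category `Tails(R) = Gr(R)/Tors(R)`: the localization of `Gr(R)` at the morphisms
whose kernel and cokernel are torsion. -/
abbrev Tails := (GrMod.isoModTorsion 𝒜).Localization

/-- The projection functor `π : Gr(R) ⥤ Tails(R)`. -/
abbrev Tails.π : GrMod 𝒜 ⥤ Tails 𝒜 := (GrMod.isoModTorsion 𝒜).Q

/-- The torsion class of `Tails(R)` cogenerated by an object `F`: all `X` with `Hom(X, F) = 0`, that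
is, such that the only morphism from `X` to `F` is the zero morphism. -/
def Tails.torsionClass (F : Tails 𝒜) : ObjectProperty (Tails 𝒜) := fun X => Subsingleton (X ⟶ F)

/-- The set of the torsion classes of `Tails(R)` cogenerated by the objects `π E`, with `E` running
over the indecomposable injective objects of `Gr(R)` whose assassinator ideal is not `R₊`. -/
def Tails.injectiveTorsionClasses [GradedAlgebra 𝒜] : Set (ObjectProperty (Tails 𝒜)) :=
  {T | ∃ E : GrMod 𝒜, CategoryTheory.Injective E ∧ Indecomposable E ∧
    (∃ P : TwoSidedIdeal R, E.IsAssassinator P ∧ P ≠ irrelevantIdeal 𝒜) ∧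
    T = Tails.torsionClass 𝒜 ((Tails.π 𝒜).obj E)}

end Tails

/-! Every object of `Tails 𝒜` is `πM` for a graded module `M`, and `πM` is zero once `M` is torsion
(`isZero_π_obj`). So it suffices to find, for `M` with a nontorsion element `x`, an admissible `E`
and a nonzero morphism `πM ⟶ πE`.

Choose a homogeneous `D ≤ M` maximal among those modulo which `x` is not torsion. Modulo any
strictly larger homogeneous submodule `x` is torsion. Being torsion passes to finite intersections
and torsion is closed under extensions, so `U = M/D` is uniform and torsion-free
(`exists_uniform_torsionFree_quotient`). The noetherian hypothesis makes torsion a finitary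
condition (`exists_finset_isTorsionModulo`), which yields both the chain condition for Zorn and the
closure under extensions. The graded injective hull `E` of `U` (`exists_injective_hull`) inherits
both properties by essentiality, and a nonzero uniform module is indecomposable.

For torsion-free injective `E`, the functor `Hom(-, E)` inverts the morphisms with torsion kernel
and cokernel, so it factors through the localization and the nonzero composite `M ⟶ U ⟶ E` stays
nonzero in `Tails 𝒜` (`eq_of_π_map_eq`). A maximal annihilator in `E` is prime
(`exists_isAssassinator`). It kills a nonzero submodule, so it cannot be `R₊`: that submodule would
be torsion. -/

namespace GrMod

open DirectSum

variable {K : Type v} {R : Type u} [Field K] [Ring R] [Algebra K R] {𝒜 : ℕ → Submodule K R}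

/-! ### Homogeneous components -/

/-- The homogeneous component of degree `n`, as an additive map. -/
def comp (M : GrMod 𝒜) (n : ℤ) : M →+ M where
  toFun x := (decompose M.deg x n : M)
  map_zero' := by simp
  map_add' x y := by simp

lemma comp_mem (M : GrMod 𝒜) (n : ℤ) (x : M) : M.comp n x ∈ M.deg n :=
  (decompose M.deg x n).2

lemma comp_of_mem {M : GrMod 𝒜} {n : ℤ} {x : M} (hx : x ∈ M.deg n) : M.comp n x = x :=
  decompose_of_mem_same _ hx

lemma comp_of_mem_of_ne {M : GrMod 𝒜} {n m : ℤ} {x : M} (hx : x ∈ M.deg n) (h : n ≠ m) :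
    M.comp m x = 0 :=
  decompose_of_mem_ne _ hx h

lemma homogeneous_induction (M : GrMod 𝒜) {p : M → Prop} (zero : p 0)
    (hom : ∀ n, ∀ x ∈ M.deg n, p x) (add : ∀ x y, p x → p y → p (x + y)) (x : M) : p x :=
  Decomposition.inductionOn M.deg zero (fun m => hom _ _ m.2) add x

lemma comp_hom_apply {M N : GrMod 𝒜} (f : M ⟶ N) (n : ℤ) (x : M) :
    N.comp n (f.hom x) = f.hom (M.comp n x) := by
  induction x using M.homogeneous_induction with
  | zero => simp
  | hom m x hx =>
    by_cases h : m = n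
    · subst h; rw [comp_of_mem hx, comp_of_mem (f.map_deg _ _ hx)]
    · rw [comp_of_mem_of_ne hx h, comp_of_mem_of_ne (f.map_deg _ _ hx) h, map_zero]
  | add x y hx hy => simp [hx, hy]

lemma comp_smul (M : GrMod 𝒜) {i : ℕ} {r : R} (hr : r ∈ 𝒜 i) (n : ℤ) (x : M) :
    M.comp (n + i) (op r • x) = op r • M.comp n x := by
  induction x using M.homogeneous_induction with
  | zero => simp
  | hom m x hx =>
    by_cases h : m = n
    · subst h; rw [comp_of_mem hx, comp_of_mem (M.smul_mem' _ _ _ _ hr hx)]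
    · rw [comp_of_mem_of_ne hx h, comp_of_mem_of_ne (M.smul_mem' _ _ _ _ hr hx) (by omega),
        smul_zero]
  | add x y hx hy => simp [hx, hy]

lemma eq_zero_of_comp {M : GrMod 𝒜} {x : M} (h : ∀ n, M.comp n x = 0) : x = 0 := by
  classical
  rw [← sum_support_decompose M.deg x]
  exact Finset.sum_eq_zero fun n _ => h n

/-! ### Homogeneous submodules -/

lemma isHomogeneous_bot (M : GrMod 𝒜) : (⊥ : Submodule Rᵐᵒᵖ M).IsHomogeneous M.deg := by
  intro n x hx
  rw [Submodule.mem_bot] at hx ⊢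
  rw [hx]; exact (M.comp n).map_zero

lemma isHomogeneous_comap {M N : GrMod 𝒜} (f : M ⟶ N) {A : Submodule Rᵐᵒᵖ N}
    (hA : A.IsHomogeneous N.deg) : (A.comap f.hom).IsHomogeneous M.deg := by
  intro n x hx
  have := hA n hx
  change f.hom (M.comp n x) ∈ A
  rw [← comp_hom_apply]; exact this

lemma isHomogeneous_ker {M N : GrMod 𝒜} (f : M ⟶ N) :
    (LinearMap.ker f.hom).IsHomogeneous M.deg :=
  isHomogeneous_comap f (isHomogeneous_bot N)

lemma isHomogeneous_range {M N : GrMod 𝒜} (f : M ⟶ N) :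
    (LinearMap.range f.hom).IsHomogeneous N.deg := by
  rintro n _ ⟨x, rfl⟩
  exact ⟨M.comp n x, (comp_hom_apply f n x).symm⟩

lemma isHomogeneous_sSup_of_directedOn {M : GrMod 𝒜} {c : Set (Submodule Rᵐᵒᵖ M)}
    (hne : c.Nonempty) (hc : DirectedOn (· ≤ ·) c) (h : ∀ A ∈ c, A.IsHomogeneous M.deg) :
    (sSup c).IsHomogeneous M.deg := by
  intro n x hx
  rw [Submodule.mem_sSup_of_directed hne hc] at hx ⊢
  obtain ⟨A, hA, hx⟩ := hx
  exact ⟨A, hA, h A hA n hx⟩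

/-- A homogeneous submodule disjoint from `A` is contained in a maximal such. -/
lemma exists_maximal_disjoint {M : GrMod 𝒜} (A C₀ : Submodule Rᵐᵒᵖ M)
    (h₀ : C₀.IsHomogeneous M.deg) (hA : C₀ ⊓ A = ⊥) :
    ∃ C, C₀ ≤ C ∧ Maximal (fun C : Submodule Rᵐᵒᵖ M => C.IsHomogeneous M.deg ∧ C ⊓ A = ⊥) C := by
  refine zorn_le_nonempty₀ _ (fun c hc hchain C hC => ?_) C₀ ⟨h₀, hA⟩
  have hd : DirectedOn (· ≤ ·) c := hchain.directedOn
  refine ⟨sSup c, ⟨isHomogeneous_sSup_of_directedOn ⟨C, hC⟩ hd fun A hA => (hc hA).1, ?_⟩,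
    fun _ h => le_sSup h⟩
  rw [eq_bot_iff]
  rintro x ⟨hx, hxA⟩
  obtain ⟨D, hD, hx⟩ := (Submodule.mem_sSup_of_directed ⟨C, hC⟩ hd).1 hx
  rw [← (hc hD).2]
  exact ⟨hx, hxA⟩

/-! ### Submodules and quotients -/

/-- A homogeneous submodule, as a graded module. -/
noncomputable def sub (M : GrMod 𝒜) (A : Submodule Rᵐᵒᵖ M) (hA : A.IsHomogeneous M.deg) :
    GrMod 𝒜 where
  carrier := A
  deg n := (M.deg n).comap A.subtype.toAddMonoidHom
  decomposition := by
    classical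
    refine DirectSum.IsInternal.chooseDecomposition _ ⟨?_, ?_⟩
    · let g : (⨁ n, (M.deg n).comap A.subtype.toAddMonoidHom) →+ ⨁ n, M.deg n :=
        DirectSum.map fun n => (A.subtype.toAddMonoidHom.comp (AddSubgroup.subtype _)).codRestrict
          (M.deg n) fun x => x.2
      have key : (DirectSum.coeAddMonoidHom M.deg).comp g =
          A.subtype.toAddMonoidHom.comp (DirectSum.coeAddMonoidHom _) := by
        ext n x : 2
        simp only [g, AddMonoidHom.comp_apply, DirectSum.map_of, DirectSum.coeAddMonoidHom_of]
        rfl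
      have hg : Function.Injective g := by
        refine (DirectSum.map_injective _).2 fun n x y h => ?_
        exact Subtype.ext (Subtype.ext (congrArg (fun z : M.deg n => (z : M)) h))
      intro x y hxy
      apply hg
      apply (Decomposition.isInternal M.deg).injective
      have hx := DFunLike.congr_fun key x
      have hy := DFunLike.congr_fun key y
      simp only [AddMonoidHom.comp_apply] at hx hy
      rw [hx, hy, hxy]
    · intro x
      refine ⟨∑ n ∈ (decompose M.deg (x : M)).support,
        DirectSum.of (fun n => (M.deg n).comap A.subtype.toAddMonoidHom) n
          ⟨⟨M.comp n x, hA n x.2⟩, M.comp_mem n x⟩, ?_⟩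
      rw [map_sum]
      simp only [DirectSum.coeAddMonoidHom_of]
      apply Subtype.ext
      rw [AddSubmonoidClass.coe_finsetSum]
      exact sum_support_decompose M.deg (x : M)
  smul_mem' i n r x hr hx := M.smul_mem' i n r x hr hx

/-- The inclusion of a homogeneous submodule. -/
noncomputable def subι (M : GrMod 𝒜) (A : Submodule Rᵐᵒᵖ M) (hA : A.IsHomogeneous M.deg) :
    M.sub A hA ⟶ M :=
  ⟨A.subtype, fun _ _ h => h⟩

/-- The quotient by a homogeneous submodule, as a graded module. -/
noncomputable def quot (M : GrMod 𝒜) (A : Submodule Rᵐᵒᵖ M) (hA : A.IsHomogeneous M.deg) :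
    GrMod 𝒜 where
  carrier := M ⧸ A
  deg n := (M.deg n).map A.mkQ.toAddMonoidHom
  decomposition := by
    classical
    have hc : ∀ n, ∀ x ∈ A, A.mkQ (M.comp n x) = 0 := fun n x hx => by
      rw [Submodule.mkQ_apply, Submodule.Quotient.mk_eq_zero]; exact hA n hx
    refine DirectSum.IsInternal.chooseDecomposition _ ⟨?_, ?_⟩
    -- Since `A` is homogeneous, the component maps descend to the quotient. They recover each
    -- summand from the sum, whence injectivity.
    · let c : ∀ n : ℤ, (M ⧸ A) →+ (M ⧸ A) := fun n =>
        QuotientAddGroup.lift A.toAddSubgroup (A.mkQ.toAddMonoidHom.comp (M.comp n)) (hc n)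
      have hcmk : ∀ n x, c n (A.mkQ x) = A.mkQ (M.comp n x) := fun n x => rfl
      have key : ∀ (m : ℤ) (d : ⨁ n, (M.deg n).map A.mkQ.toAddMonoidHom),
          c m (DirectSum.coeAddMonoidHom _ d) = (d m : M ⧸ A) := by
        intro m d
        induction d using DirectSum.induction_on with
        | zero => simp
        | of i x =>
          obtain ⟨_, x, hx, rfl⟩ := x
          rw [DirectSum.coeAddMonoidHom_of]
          change c m (A.mkQ x) = _
          rw [hcmk]
          by_cases h : i = m
          · subst h; rw [DirectSum.of_eq_same, comp_of_mem hx]; rfl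
          · rw [DirectSum.of_eq_of_ne _ _ _ (Ne.symm h), comp_of_mem_of_ne hx h]; simp
        | add x y hx hy => simp [hx, hy]
      intro x y hxy
      refine DFinsupp.ext fun m => Subtype.ext ?_
      rw [← key m x, ← key m y, hxy]
    · intro x
      obtain ⟨x, rfl⟩ := A.mkQ_surjective x
      refine ⟨∑ n ∈ (decompose M.deg x).support,
        DirectSum.of (fun n => (M.deg n).map A.mkQ.toAddMonoidHom) n
          ⟨A.mkQ (M.comp n x), M.comp n x, M.comp_mem n x, rfl⟩, ?_⟩
      rw [map_sum]
      simp only [DirectSum.coeAddMonoidHom_of]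
      rw [← map_sum]
      exact congrArg _ (sum_support_decompose M.deg x)
  smul_mem' := by
    rintro i n r _ hr ⟨x, hx, rfl⟩
    exact ⟨op r • x, M.smul_mem' i n r x hr hx, rfl⟩

/-- The projection onto the quotient by a homogeneous submodule. -/
noncomputable def quotπ (M : GrMod 𝒜) (A : Submodule Rᵐᵒᵖ M) (hA : A.IsHomogeneous M.deg) :
    M ⟶ M.quot A hA :=
  ⟨A.mkQ, fun _ x h => ⟨x, h, rfl⟩⟩

lemma quotπ_surjective (M : GrMod 𝒜) (A : Submodule Rᵐᵒᵖ M) (hA : A.IsHomogeneous M.deg) :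
    Function.Surjective (M.quotπ A hA).hom :=
  A.mkQ_surjective

lemma quotπ_apply_eq_zero {M : GrMod 𝒜} {A : Submodule Rᵐᵒᵖ M} {hA : A.IsHomogeneous M.deg}
    {x : M} : (M.quotπ A hA).hom x = 0 ↔ x ∈ A :=
  Submodule.Quotient.mk_eq_zero A

/-- The morphism from a quotient induced by a morphism killing the submodule. -/
noncomputable def quotDesc {M N : GrMod 𝒜} (A : Submodule Rᵐᵒᵖ M) (hA : A.IsHomogeneous M.deg)
    (f : M ⟶ N) (hf : A ≤ LinearMap.ker f.hom) : M.quot A hA ⟶ N :=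
  ⟨A.liftQ f.hom hf, by rintro n _ ⟨x, hx, rfl⟩; exact f.map_deg n x hx⟩

/-! ### Monomorphisms, zero objects, injective objects -/

lemma mono_of_injective {M N : GrMod 𝒜} (f : M ⟶ N) (hf : Function.Injective f.hom) : Mono f where
  right_cancellation g h e := by
    ext1
    refine LinearMap.ext fun x => hf ?_
    exact congrArg (fun k : _ ⟶ N => k.hom x) e

/-- The inclusion of the kernel and the zero map agree after composing with `f`. -/
lemma injective_of_mono {M N : GrMod 𝒜} (f : M ⟶ N) [Mono f] : Function.Injective f.hom := by
  rw [← LinearMap.ker_eq_bot, eq_bot_iff]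
  intro x hx
  have h : M.subι _ (isHomogeneous_ker f) = 0 := by
    rw [← cancel_mono f, zero_comp]
    ext1
    exact LinearMap.ext fun y => y.2
  exact congrArg (fun k : M.sub _ (isHomogeneous_ker f) ⟶ M => k.hom ⟨x, hx⟩) h

lemma isZero_iff_subsingleton (M : GrMod 𝒜) : IsZero M ↔ Subsingleton M := by
  rw [IsZero.iff_id_eq_zero]
  constructor
  · intro h
    refine ⟨fun x y => ?_⟩
    have h' : ∀ z : M, z = 0 := fun z => congrArg (fun k : M ⟶ M => k.hom z) h
    rw [h' x, h' y]
  · intro h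
    ext1
    exact LinearMap.ext fun x => Subsingleton.elim _ _

/-- A morphism into an injective object extends along any morphism with smaller kernel. -/
lemma exists_extension {A B E : GrMod 𝒜} [Injective E] (s : A ⟶ B) (f : A ⟶ E)
    (h : LinearMap.ker s.hom ≤ LinearMap.ker f.hom) : ∃ g : B ⟶ E, s ≫ g = f := by
  -- Both `s` and `f` factor through `A / ker s`, which embeds into `B`.
  let s' := quotDesc _ (isHomogeneous_ker s) s le_rfl
  have : Mono s' := mono_of_injective _ <| by
    rw [← LinearMap.ker_eq_bot, eq_bot_iff]
    intro x hx
    obtain ⟨x, rfl⟩ := quotπ_surjective _ _ (isHomogeneous_ker s) x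
    exact quotπ_apply_eq_zero.2 hx
  refine ⟨Injective.factorThru (quotDesc _ (isHomogeneous_ker s) f h) s', ?_⟩
  ext1
  refine LinearMap.ext fun x => ?_
  have := Injective.comp_factorThru (quotDesc _ (isHomogeneous_ker s) f h) s'
  exact congrArg (fun k : _ ⟶ E => k.hom ((A.quotπ _ (isHomogeneous_ker s)).hom x)) this

section Torsion

/-! ### Torsion -/

lemma IsTorsionModulo.mono {M : GrMod 𝒜} {L L' : Submodule Rᵐᵒᵖ M} (h : L ≤ L') {x : M}
    (hx : IsTorsionModulo L x) : IsTorsionModulo L' x := by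
  obtain ⟨N, hN⟩ := hx
  exact ⟨N, fun j hj r hr => h (hN j hj r hr)⟩

lemma isTorsionModulo_of_mem {M : GrMod 𝒜} {L : Submodule Rᵐᵒᵖ M} {x : M} (hx : x ∈ L) :
    IsTorsionModulo L x :=
  ⟨0, fun _ _ _ _ => L.smul_mem _ hx⟩

lemma IsTorsionModulo.inf {M : GrMod 𝒜} {L L' : Submodule Rᵐᵒᵖ M} {x : M}
    (hx : IsTorsionModulo L x) (hx' : IsTorsionModulo L' x) : IsTorsionModulo (L ⊓ L') x := by
  obtain ⟨N, hN⟩ := hx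
  obtain ⟨N', hN'⟩ := hx'
  exact ⟨max N N', fun j hj r hr => ⟨hN j (lt_of_le_of_lt (le_max_left _ _) hj) r hr,
    hN' j (lt_of_le_of_lt (le_max_right _ _) hj) r hr⟩⟩

lemma IsTorsionModulo.add {M : GrMod 𝒜} {L : Submodule Rᵐᵒᵖ M} {x y : M}
    (hx : IsTorsionModulo L x) (hy : IsTorsionModulo L y) : IsTorsionModulo L (x + y) := by
  obtain ⟨N, hN⟩ := hx
  obtain ⟨N', hN'⟩ := hy
  refine ⟨max N N', fun j hj r hr => ?_⟩
  rw [smul_add]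
  exact L.add_mem (hN j (lt_of_le_of_lt (le_max_left _ _) hj) r hr)
    (hN' j (lt_of_le_of_lt (le_max_right _ _) hj) r hr)

lemma isTorsionModulo_comap_iff {M N : GrMod 𝒜} (f : M ⟶ N) (L : Submodule Rᵐᵒᵖ N) (x : M) :
    IsTorsionModulo (L.comap f.hom) x ↔ IsTorsionModulo L (f.hom x) := by
  simp [IsTorsionModulo]

lemma isTorsionModulo_ker_iff {M N : GrMod 𝒜} (f : M ⟶ N) (x : M) :
    IsTorsionModulo (LinearMap.ker f.hom) x ↔ IsTorsionModulo ⊥ (f.hom x) :=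
  isTorsionModulo_comap_iff f ⊥ x

/-- A graded module is torsion-free if zero is its only torsion element. -/
def IsTorsionFree (M : GrMod 𝒜) : Prop :=
  ∀ x : M, IsTorsionModulo (⊥ : Submodule Rᵐᵒᵖ M) x → x = 0

/-- A graded module is uniform if its nonzero homogeneous submodules meet nontrivially. -/
def IsUniform (M : GrMod 𝒜) : Prop :=
  ∀ A B : Submodule Rᵐᵒᵖ M, A.IsHomogeneous M.deg → B.IsHomogeneous M.deg →
    A ≠ ⊥ → B ≠ ⊥ → A ⊓ B ≠ ⊥

/-! ### Annihilators -/

lemma mem_annihilator {M : GrMod 𝒜} {N : Submodule Rᵐᵒᵖ M} {r : R} :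
    r ∈ annihilator N ↔ ∀ x ∈ N, op r • x = 0 :=
  TwoSidedIdeal.mem_mk' ..

lemma annihilator_anti {M : GrMod 𝒜} {N N' : Submodule Rᵐᵒᵖ M} (h : N ≤ N') :
    annihilator N' ≤ annihilator N := fun _ hr =>
  mem_annihilator.2 fun x hx => mem_annihilator.1 hr x (h hx)

variable [GradedAlgebra 𝒜]

/-! ### The torsion submodule -/

lemma IsTorsionModulo.smul {M : GrMod 𝒜} {L : Submodule Rᵐᵒᵖ M} {x : M}
    (hx : IsTorsionModulo L x) (r : Rᵐᵒᵖ) : IsTorsionModulo L (r • x) := by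
  obtain ⟨r, rfl⟩ := op_surjective r
  induction r using Decomposition.inductionOn 𝒜 with
  | zero => simpa using isTorsionModulo_of_mem L.zero_mem
  | homogeneous s =>
    rename_i i
    obtain ⟨N, hN⟩ := hx
    refine ⟨N, fun j hj r hr => ?_⟩
    rw [smul_smul, ← op_mul]
    exact hN (i + j) (by omega) _ (SetLike.mul_mem_graded s.2 hr)
  | add r s hr hs => rw [MulOpposite.op_add, add_smul]; exact hr.add hs

/-- The submodule of the elements which are torsion modulo `L`. -/
def torsionModulo {M : GrMod 𝒜} (L : Submodule Rᵐᵒᵖ M) : Submodule Rᵐᵒᵖ M where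
  carrier := {x | IsTorsionModulo L x}
  zero_mem' := isTorsionModulo_of_mem L.zero_mem
  add_mem' := IsTorsionModulo.add
  smul_mem' r _ hx := hx.smul r

lemma isHomogeneous_torsionModulo {M : GrMod 𝒜} {L : Submodule Rᵐᵒᵖ M}
    (hL : L.IsHomogeneous M.deg) : (torsionModulo L).IsHomogeneous M.deg := by
  rintro n x ⟨N, hN⟩
  refine ⟨N, fun j hj r hr => ?_⟩
  change op r • M.comp n x ∈ L
  rw [← comp_smul M hr]
  exact hL _ (hN j hj r hr)

/-! ### Finiteness of torsion over a right noetherian algebra -/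

variable (𝒜) in
/-- Over a right noetherian algebra, torsion is detected on finitely many homogeneous multiples of
arbitrarily high degree. -/
lemma exists_finset_isTorsionModulo (hnoeth : IsNoetherianRing Rᵐᵒᵖ) (N : ℕ) :
    ∃ S : Finset R, (∀ g ∈ S, ∃ d, N < d ∧ g ∈ 𝒜 d) ∧
      ∀ (M : GrMod 𝒜) (L : Submodule Rᵐᵒᵖ M) (x : M),
        (∀ g ∈ S, IsTorsionModulo L (op g • x)) → IsTorsionModulo L x := by
  classical
  let G : Set Rᵐᵒᵖ := {g | ∃ d, N < d ∧ g.unop ∈ 𝒜 d}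
  -- The right ideal generated by all homogeneous elements of degree above `N` is generated by
  -- finitely many of them.
  obtain ⟨S, hSG, hS⟩ := (Submodule.fg_span_iff_fg_span_finset_subset (R := Rᵐᵒᵖ) G).1
    (IsNoetherian.noetherian _)
  refine ⟨S.image unop, fun g hg => ?_, fun M L x hx => ?_⟩
  · obtain ⟨g', hg', rfl⟩ := Finset.mem_image.1 hg
    exact hSG (Finset.mem_coe.2 hg')
  have hd : ∀ g ∈ S, ∃ d, N < d ∧ g.unop ∈ 𝒜 d := fun g hg =>
    hSG (Finset.mem_coe.2 hg)
  choose! d hNd hd using hd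
  have hx : ∀ g ∈ S, IsTorsionModulo L (g • x) := fun g hg =>
    hx g.unop (Finset.mem_image_of_mem _ hg)
  choose! B hB using hx
  -- Beyond this bound, `j > N` puts `r` in the right ideal, and `j - d g > B g` holds for every
  -- generator `g`.
  refine ⟨N + ∑ g ∈ S, (d g + B g), fun j hj r hr => ?_⟩
  have hrG : op r ∈ Submodule.span Rᵐᵒᵖ G := Submodule.subset_span ⟨j, by omega, hr⟩
  rw [hS, Submodule.mem_span_finset] at hrG
  obtain ⟨c, -, hc⟩ := hrG
  -- Taking components of degree `j` in `r = ∑ g * c g` replaces each coefficient by its component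
  -- of degree `j - d g`.
  have hr' : r = ∑ g ∈ S, g.unop * (decompose 𝒜 (c g).unop (j - d g) : R) := by
    have hle : ∀ g ∈ S, d g + B g < j := fun g hg =>
      lt_of_le_of_lt ((Finset.single_le_sum (f := fun g => d g + B g) (fun _ _ => Nat.zero_le _)
        hg).trans (Nat.le_add_left _ _)) hj
    have h1 : r = ∑ g ∈ S, g.unop * (c g).unop := by
      have := congrArg unop hc
      simpa using this.symm
    conv_lhs => rw [← decompose_of_mem_same 𝒜 hr, h1]
    rw [decompose_sum, DFinsupp.finsetSum_apply, AddSubmonoidClass.coe_finsetSum]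
    refine Finset.sum_congr rfl fun g hg => ?_
    rw [coe_decompose_mul_of_left_mem_of_le 𝒜 (hd g hg) (by have := hle g hg; omega)]
  rw [hr', Finset.op_sum, Finset.sum_smul]
  refine L.sum_mem fun g hg => ?_
  rw [op_mul, op_unop, mul_smul]
  have hle : d g + B g < j :=
    lt_of_le_of_lt ((Finset.single_le_sum (f := fun g => d g + B g) (fun _ _ => Nat.zero_le _)
        hg).trans (Nat.le_add_left _ _)) hj
  exact hB g hg (j - d g) (by omega) _ (SetLike.coe_mem _)

/-- Torsion is closed under extensions. The bounds for the various `x r` need not be uniform in `r`,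
but only the finitely many `x g` with `g ∈ S` matter. -/
lemma IsTorsionModulo.trans (hnoeth : IsNoetherianRing Rᵐᵒᵖ) {M : GrMod 𝒜}
    {L : Submodule Rᵐᵒᵖ M} {x : M} (hx : IsTorsionModulo (torsionModulo L) x) :
    IsTorsionModulo L x := by
  obtain ⟨N, hN⟩ := hx
  obtain ⟨S, hS, h⟩ := exists_finset_isTorsionModulo 𝒜 hnoeth N
  refine h M L x fun g hg => ?_
  obtain ⟨d, hd, hg⟩ := hS g hg
  exact hN d hd g hg

/-- The finitely many test elements `x g` already lie in a single member of the chain. This is the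
chain condition behind the choice of a maximal `D` below. -/
lemma exists_isTorsionModulo_of_sSup (hnoeth : IsNoetherianRing Rᵐᵒᵖ) {M : GrMod 𝒜}
    {c : Set (Submodule Rᵐᵒᵖ M)} (hne : c.Nonempty) (hc : IsChain (· ≤ ·) c) {x : M}
    (hx : IsTorsionModulo (sSup c) x) : ∃ L ∈ c, IsTorsionModulo L x := by
  classical
  obtain ⟨N, hN⟩ := hx
  obtain ⟨S, hS, h⟩ := exists_finset_isTorsionModulo 𝒜 hnoeth N
  suffices ∀ T ⊆ S, ∃ L ∈ c, ∀ g ∈ T, op g • x ∈ L by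
    obtain ⟨L, hL, hLS⟩ := this S subset_rfl
    exact ⟨L, hL, h M L x fun g hg => isTorsionModulo_of_mem (hLS g hg)⟩
  intro T
  induction T using Finset.induction_on with
  | empty => exact fun _ => ⟨hne.some, hne.some_mem, by simp⟩
  | insert a T _ ih =>
    intro hT
    obtain ⟨L, hL, hLT⟩ := ih ((Finset.subset_insert _ _).trans hT)
    obtain ⟨d, hd, ha⟩ := hS a (hT (Finset.mem_insert_self _ _))
    obtain ⟨L', hL', haL'⟩ := (Submodule.mem_sSup_of_directed hne hc.directedOn).1 (hN d hd a ha)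
    obtain ⟨L'', hL'', h1, h2⟩ := hc.directedOn L hL L' hL'
    refine ⟨L'', hL'', fun g hg => ?_⟩
    rcases Finset.mem_insert.1 hg with rfl | hg
    · exact h2 haL'
    · exact h1 (hLT g hg)

/-- A graded module which is not torsion has a nonzero uniform torsion-free quotient. -/
lemma exists_uniform_torsionFree_quotient (hnoeth : IsNoetherianRing Rᵐᵒᵖ) {M : GrMod 𝒜} {x : M}
    (hx : ¬ IsTorsionModulo (⊥ : Submodule Rᵐᵒᵖ M) x) :
    ∃ (U : GrMod 𝒜) (f : M ⟶ U), f ≠ 0 ∧ U.IsTorsionFree ∧ U.IsUniform := by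
  obtain ⟨D, -, hD⟩ := zorn_le_nonempty₀
    {D : Submodule Rᵐᵒᵖ M | D.IsHomogeneous M.deg ∧ ¬ IsTorsionModulo D x}
    (fun c hc hchain C hC => by
      refine ⟨sSup c, ⟨isHomogeneous_sSup_of_directedOn ⟨C, hC⟩ hchain.directedOn
        fun A hA => (hc hA).1, fun h => ?_⟩, fun _ h => le_sSup h⟩
      obtain ⟨L, hL, h⟩ := exists_isTorsionModulo_of_sSup hnoeth ⟨C, hC⟩ hchain h
      exact (hc hL).2 h) ⊥ ⟨isHomogeneous_bot M, hx⟩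
  have hDh := hD.prop.1
  -- The pullback of a nonzero `A` strictly contains `D`, so the maximality of `D` applies.
  have hlarge : ∀ A : Submodule Rᵐᵒᵖ (M.quot D hDh), A.IsHomogeneous (M.quot D hDh).deg →
      A ≠ ⊥ → IsTorsionModulo (A.comap (M.quotπ D hDh).hom) x := by
    intro A hA hne
    by_contra h
    refine hne ?_
    have hle : D ≤ A.comap (M.quotπ D hDh).hom := fun y hy => by
      rw [Submodule.mem_comap, quotπ_apply_eq_zero.2 hy]; exact A.zero_mem
    rw [eq_bot_iff]
    intro y hy
    obtain ⟨y, rfl⟩ := quotπ_surjective _ _ hDh y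
    exact quotπ_apply_eq_zero.2 (hD.le_of_ge ⟨isHomogeneous_comap _ hA, h⟩ hle hy)
  have hker : LinearMap.ker (M.quotπ D hDh).hom = D := Submodule.ker_mkQ D
  refine ⟨M.quot D hDh, M.quotπ D hDh, fun h => ?_, fun y hy => ?_, fun A B hA hB hA0 hB0 h => ?_⟩
  · apply hD.prop.2
    rw [← hker, isTorsionModulo_ker_iff, h]
    exact isTorsionModulo_of_mem (Submodule.zero_mem _)
  -- If the torsion submodule were nonzero, `x` would be torsion modulo its pullback, hence torsion
  -- modulo `D` by transitivity.
  · by_contra hy0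
    have := hlarge (torsionModulo ⊥) (isHomogeneous_torsionModulo (isHomogeneous_bot _))
      fun h => hy0 ((Submodule.eq_bot_iff _).1 h y hy)
    rw [isTorsionModulo_comap_iff] at this
    apply hD.prop.2
    rw [← hker, isTorsionModulo_ker_iff]
    exact this.trans hnoeth
  -- Were `A ⊓ B` zero, the two pullbacks would intersect in `D`, making `x` torsion modulo `D`.
  · have := (hlarge A hA hA0).inf (hlarge B hB hB0)
    rw [← Submodule.comap_inf, h] at this
    exact hD.prop.2 (hker ▸ this)

/-! ### Assassinators -/

lemma comp_smul_of_mem {M : GrMod 𝒜} {n : ℤ} {x : M} (hx : x ∈ M.deg n) (r : R) (i : ℕ) :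
    M.comp (n + i) (op r • x) = op (decompose 𝒜 r i : R) • x := by
  induction r using Decomposition.inductionOn 𝒜 with
  | zero => simp
  | homogeneous s =>
    rename_i j
    have hs := M.smul_mem' j n s x s.2 hx
    by_cases h : j = i
    · subst h; rw [comp_of_mem hs, decompose_of_mem_same 𝒜 s.2]
    · rw [comp_of_mem_of_ne hs (by omega), decompose_of_mem_ne 𝒜 s.2 h]; simp
  | add r s hr hs => simp [add_smul, hr, hs]

/-- For homogeneous `y`, the products of `y` with the components of `r` lie in distinct degrees, so
`y r = 0` kills each of them. The components of `x ∈ N` are such `y` in `N`. -/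
lemma decompose_mem_annihilator {M : GrMod 𝒜} {N : Submodule Rᵐᵒᵖ M}
    (hN : N.IsHomogeneous M.deg) {r : R} (hr : r ∈ annihilator N) (i : ℕ) :
    (decompose 𝒜 r i : R) ∈ annihilator N := by
  refine mem_annihilator.2 fun x hx => eq_zero_of_comp fun n => ?_
  have h : M.comp (n - i + i) (op (decompose 𝒜 r i : R) • x) = 0 := by
    rw [comp_smul M (SetLike.coe_mem _), ← comp_smul_of_mem (M.comp_mem _ x),
      mem_annihilator.1 hr (M.comp _ x) (hN _ hx), map_zero]
  rwa [sub_add_cancel] at h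

lemma isHomogeneous_span_singleton {M : GrMod 𝒜} {n : ℤ} {x : M} (hx : x ∈ M.deg n) :
    (Submodule.span Rᵐᵒᵖ {x}).IsHomogeneous M.deg := by
  intro m y hy
  obtain ⟨r, rfl⟩ := Submodule.mem_span_singleton.1 hy
  obtain ⟨r, rfl⟩ := op_surjective r
  clear hy
  change M.comp m _ ∈ _
  induction r using Decomposition.inductionOn 𝒜 with
  | zero => simp
  | homogeneous s =>
    rename_i j
    have hs := M.smul_mem' j n s x s.2 hx
    by_cases h : n + j = m
    · subst h; rw [comp_of_mem hs]
      exact Submodule.smul_mem _ _ (Submodule.mem_span_singleton_self x)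
    · rw [comp_of_mem_of_ne hs h]; exact Submodule.zero_mem _
  | add r s hr hs => rw [MulOpposite.op_add, add_smul, map_add]; exact Submodule.add_mem _ hr hs

/-- Outside a homogeneous ideal, every element has a component outside of the ideal, all of whose
higher components lie in the ideal. -/
lemma exists_top_component {P : TwoSidedIdeal R} {a : R} (ha : a ∉ P) :
    ∃ m, (decompose 𝒜 a m : R) ∉ P ∧ ∀ i, m < i → (decompose 𝒜 a i : R) ∈ P := by
  classical
  let s := (decompose 𝒜 a).support.filter fun i => (decompose 𝒜 a i : R) ∉ P
  have hs : s.Nonempty := by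
    by_contra h
    rw [Finset.not_nonempty_iff_eq_empty, Finset.filter_eq_empty_iff] at h
    apply ha
    rw [← sum_support_decompose 𝒜 a]
    exact sum_mem fun i hi => not_not.1 (h hi)
  refine ⟨s.max' hs, (Finset.mem_filter.1 (s.max'_mem hs)).2, fun i hi => ?_⟩
  by_contra h
  refine absurd (s.le_max' i (Finset.mem_filter.2 ⟨?_, h⟩)) (by omega)
  rw [DFinsupp.mem_support_iff]
  rintro h0
  exact h (by rw [h0]; exact P.zero_mem)

/-- In degree `m + n` of `a * b`, every product other than that of the two top components has a
factor above its top degree, hence in `P`. -/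
lemma decompose_mul_sub_mem {P : TwoSidedIdeal R} {a b : R} {m n : ℕ}
    (ha : ∀ i, m < i → (decompose 𝒜 a i : R) ∈ P) (hb : ∀ i, n < i → (decompose 𝒜 b i : R) ∈ P) :
    (decompose 𝒜 (a * b) (m + n) : R) - (decompose 𝒜 a m : R) * (decompose 𝒜 b n : R) ∈ P := by
  rw [decompose_mul, coe_mul_apply_eq_sum_antidiagonal,
    ← Finset.add_sum_erase _ _ (Finset.HasAntidiagonal.mem_antidiagonal.2
      (rfl : (m, n).1 + (m, n).2 = m + n)),
    add_sub_cancel_left]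
  refine sum_mem fun ij hij => ?_
  obtain ⟨hne, hij⟩ := Finset.mem_erase.1 hij
  rw [Finset.HasAntidiagonal.mem_antidiagonal] at hij
  rcases lt_trichotomy m ij.1 with h | h | h
  · exact P.mul_mem_right _ _ (ha _ h)
  · exact absurd (Prod.ext h.symm (by omega)) hne
  · exact P.mul_mem_left _ _ (hb _ (by omega))

/-- If `a R b` lies in a homogeneous ideal, so does `a' R b'` for the top components `a'`, `b'` of
`a` and `b` outside of the ideal. -/
lemma top_component_mul_mem {P : TwoSidedIdeal R}
    (hP : ∀ r ∈ P, ∀ i, (decompose 𝒜 r i : R) ∈ P) {a b : R} {m n : ℕ}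
    (ha : ∀ i, m < i → (decompose 𝒜 a i : R) ∈ P) (hb : ∀ i, n < i → (decompose 𝒜 b i : R) ∈ P)
    (hab : ∀ r, a * r * b ∈ P) (r : R) :
    (decompose 𝒜 a m : R) * r * (decompose 𝒜 b n : R) ∈ P := by
  induction r using Decomposition.inductionOn 𝒜 with
  | zero => simp
  | homogeneous s =>
    rename_i j
    have h := decompose_mul_sub_mem (𝒜 := 𝒜) (P := P) (a := a) (b := s * b) (n := j + n) ha
      fun i hi => by
        rw [coe_decompose_mul_of_left_mem_of_le 𝒜 s.2 (by omega)]
        exact P.mul_mem_left _ _ (hb _ (by omega))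
    rw [coe_decompose_mul_add_of_left_mem 𝒜 s.2, ← mul_assoc, ← mul_assoc] at h
    have := P.sub_mem (hP _ (hab s) (m + (j + n))) h
    rwa [sub_sub_cancel] at this
  | add r s hr hs => rw [mul_add, add_mul]; exact P.add_mem hr hs

/-- Over a right noetherian algebra, every nonzero graded module has an assassinator ideal. -/
lemma exists_isAssassinator (hnoeth : IsNoetherianRing Rᵐᵒᵖ) {E : GrMod 𝒜} (hE : Nontrivial E) :
    ∃ P, E.IsAssassinator P := by
  classical
  let 𝒮 : Set (TwoSidedIdeal R) :=
    {J | ∃ N : Submodule Rᵐᵒᵖ E, N.IsHomogeneous E.deg ∧ N ≠ ⊥ ∧ J = annihilator N}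
  have htop : (⊤ : Submodule Rᵐᵒᵖ E).IsHomogeneous E.deg := fun _ _ _ => trivial
  have h𝒮 : 𝒮.Nonempty := ⟨_, ⊤, htop, top_ne_bot, rfl⟩
  -- Two-sided ideals embed strictly monotonically into right ideals, so they satisfy the ascending
  -- chain condition.
  have hwf : WellFounded ((· > ·) : TwoSidedIdeal R → TwoSidedIdeal R → Prop) := by
    have hmono : StrictMono (TwoSidedIdeal.asIdealOpposite (R := R)) :=
      TwoSidedIdeal.asIdealOpposite.monotone.strictMono_of_injective fun I J h => by
        ext r
        have := SetLike.ext_iff.1 h (op r)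
        simpa [TwoSidedIdeal.mem_asIdealOpposite] using this
    have := hnoeth
    exact (hmono.wellFoundedGT).wf
  obtain ⟨P, hP, hmax⟩ : ∃ P ∈ 𝒮, ∀ Q ∈ 𝒮, ¬ Q > P :=
    ⟨hwf.min 𝒮 h𝒮, hwf.min_mem 𝒮 h𝒮, fun Q hQ => hwf.not_lt_min 𝒮 hQ⟩
  have hmax' : ∀ Q ∈ 𝒮, P ≤ Q → Q ≤ P := fun Q hQ hle => by
    by_contra h
    exact hmax Q hQ (lt_of_le_not_ge hle h)
  refine ⟨P, ⟨?_, ?_⟩, hP, fun Q hQ hle => hmax' Q hQ hle⟩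
  · rintro rfl
    obtain ⟨N, -, hN0, hN⟩ := hP
    refine hN0 ((Submodule.eq_bot_iff _).2 fun x hx => ?_)
    have h1 : (1 : R) ∈ annihilator N := hN.le trivial
    simpa using mem_annihilator.1 h1 x hx
  · intro a b hab
    by_contra! hcon
    obtain ⟨ha, hb⟩ := hcon
    obtain ⟨m, ham, hma⟩ := exists_top_component (𝒜 := 𝒜) ha
    obtain ⟨n, hbn, hnb⟩ := exists_top_component (𝒜 := 𝒜) hb
    obtain ⟨N, hN, hN0, rfl⟩ := id hP
    have key := top_component_mul_mem (fun r hr => decompose_mem_annihilator hN hr) hma hnb hab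
    -- Primeness is now tested on the top components `a'` and `b'`. With `y a' ≠ 0`, the homogeneous
    -- submodule `y a' R` is killed by `P` and, as `a' R b' ⊆ P`, by `b'`. Maximality then forces
    -- `b' ∈ P`.
    obtain ⟨k, y, hy, hyN, hya⟩ : ∃ k, ∃ y ∈ E.deg k, y ∈ N ∧ op (decompose 𝒜 a m : R) • y ≠ 0 := by
      by_contra! h
      refine ham (mem_annihilator.2 fun x hx => eq_zero_of_comp fun l => ?_)
      have := h _ _ (E.comp_mem (l - m) x) (hN _ hx)
      rw [← comp_smul E (SetLike.coe_mem _), sub_add_cancel] at this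
      exact this
    refine hbn (hmax' _ ⟨Submodule.span Rᵐᵒᵖ {op (decompose 𝒜 a m : R) • y},
      isHomogeneous_span_singleton (E.smul_mem' _ _ _ _ (SetLike.coe_mem _) hy), ?_, rfl⟩
      (annihilator_anti ?_) (mem_annihilator.2 fun x hx => ?_))
    · rwa [Ne, Submodule.span_singleton_eq_bot]
    · rw [Submodule.span_singleton_le_iff_mem]; exact N.smul_mem _ hyN
    · obtain ⟨r, rfl⟩ := Submodule.mem_span_singleton.1 hx
      obtain ⟨r, rfl⟩ := op_surjective r
      rw [smul_smul, smul_smul, ← op_mul, ← op_mul]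
      rw [← mul_assoc]
      exact mem_annihilator.1 (key r) y hyN

end Torsion

/-! ### The graded module cofreely generated by a module -/

section Cofree

variable (𝒜) [GradedAlgebra 𝒜] (I : Type u) [AddCommGroup I] [Module Rᵐᵒᵖ I]

variable {I} in
lemma laurentEnd_ext {f g : AddMonoid.End (ℤ →₀ I)}
    (h : ∀ n x, f (Finsupp.single n x) = g (Finsupp.single n x)) : f = g :=
  Finsupp.addHom_ext h

/-- The action of `r` on Laurent polynomials with coefficients in `I`, shifting degrees by `i`. -/
noncomputable def shiftEnd (i : ℕ) (r : R) : AddMonoid.End (ℤ →₀ I) :=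
  Finsupp.liftAddHom fun n : ℤ =>
    (Finsupp.singleAddHom (n + i)).comp (DistribSMul.toAddMonoidHom I (op r))

lemma shiftEnd_single (i : ℕ) (r : R) (n : ℤ) (x : I) :
    shiftEnd I i r (Finsupp.single n x) = Finsupp.single (n + i) (op r • x) :=
  Finsupp.liftAddHom_apply_single _ _ _

/-- The action of the homogeneous elements on Laurent polynomials with coefficients in `I`. -/
noncomputable def homogeneousAction (i : ℕ) : 𝒜 i →+ (AddMonoid.End (ℤ →₀ I))ᵐᵒᵖ where
  toFun r := op (shiftEnd I i (r : R))
  map_zero' := by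
    refine unop_injective (laurentEnd_ext fun n x => ?_)
    rw [unop_op, shiftEnd_single, ZeroMemClass.coe_zero, MulOpposite.op_zero, zero_smul,
      Finsupp.single_zero, MulOpposite.unop_zero]
    rfl
  map_add' r s := by
    refine unop_injective (laurentEnd_ext fun n x => ?_)
    rw [unop_op, shiftEnd_single, AddMemClass.coe_add, MulOpposite.op_add, add_smul,
      Finsupp.single_add, MulOpposite.unop_add, unop_op, unop_op, ← shiftEnd_single,
      ← shiftEnd_single]
    rfl

/-- The action of `R` on Laurent polynomials with coefficients in `I`, elements of degree `i`
shifting the degree by `i`. -/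
noncomputable def laurentActionOp : (⨁ i, 𝒜 i) →+* (AddMonoid.End (ℤ →₀ I))ᵐᵒᵖ :=
  -- A right action reverses products, so it is a ring homomorphism into the opposite of the
  -- endomorphism ring.
  DirectSum.toSemiring (homogeneousAction 𝒜 I)
    (by
      refine unop_injective (laurentEnd_ext fun n x => ?_)
      refine (shiftEnd_single I 0 (1 : R) n x).trans ?_
      rw [Nat.cast_zero, add_zero, MulOpposite.op_one, one_smul]
      rfl)
    (fun {i j} r s => by
      refine unop_injective (laurentEnd_ext fun n x => ?_)
      refine (shiftEnd_single I (i + j) (r * s : R) n x).trans ?_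
      rw [op_mul, mul_smul, Nat.cast_add, ← add_assoc, ← shiftEnd_single, ← shiftEnd_single]
      rfl)

/-- The action of `R` on Laurent polynomials with coefficients in `I`, as a ring homomorphism. -/
noncomputable def laurentAction : Rᵐᵒᵖ →+* AddMonoid.End (ℤ →₀ I) :=
  (RingEquiv.opOp _).symm.toRingHom.comp (RingHom.op
    ((laurentActionOp 𝒜 I).comp (DirectSum.decomposeRingEquiv 𝒜).toRingHom))

lemma laurentAction_single {i : ℕ} {r : R} (hr : r ∈ 𝒜 i) (n : ℤ) (x : I) :
    laurentAction 𝒜 I (op r) (Finsupp.single n x) = Finsupp.single (n + i) (op r • x) := by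
  have h : decompose 𝒜 r = DirectSum.of (fun i => 𝒜 i) i ⟨r, hr⟩ := decompose_of_mem 𝒜 hr
  have h' : laurentActionOp 𝒜 I (decompose 𝒜 r) = op (shiftEnd I i r) := by
    rw [h, laurentActionOp, DirectSum.toSemiring_of]; rfl
  rw [← shiftEnd_single]
  exact congrArg (fun f : (AddMonoid.End (ℤ →₀ I))ᵐᵒᵖ => f.unop (Finsupp.single n x)) h'

/-- The Laurent polynomials with coefficients in `I`, as a graded module. -/
noncomputable def cofree : GrMod 𝒜 where
  carrier := ℤ →₀ I
  module := Module.compHom (ℤ →₀ I) (laurentAction 𝒜 I)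
  deg n := (Finsupp.singleAddHom n).range
  decomposition := by
    classical
    refine DirectSum.IsInternal.chooseDecomposition _ ⟨?_, ?_⟩
    · have key : ∀ (m : ℤ) (d : ⨁ n : ℤ, (Finsupp.singleAddHom (M := I) n).range),
          Finsupp.single m (DirectSum.coeAddMonoidHom _ d m) = (d m : ℤ →₀ I) := by
        intro m d
        induction d using DirectSum.induction_on with
        | zero => simp
        | of i x =>
          obtain ⟨_, x, rfl⟩ := x
          rw [DirectSum.coeAddMonoidHom_of]
          by_cases h : i = m
          · subst h; simp
          · rw [DirectSum.of_eq_of_ne _ _ _ (Ne.symm h)]; simp [h]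
        | add x y hx hy => simp [hx, hy]
      intro x y hxy
      refine DFinsupp.ext fun m => Subtype.ext ?_
      rw [← key m x, ← key m y, hxy]
    · intro x
      refine ⟨∑ n ∈ x.support, DirectSum.of (fun n => (Finsupp.singleAddHom (M := I) n).range) n
          ⟨Finsupp.single n (x n), x n, rfl⟩, ?_⟩
      rw [map_sum]
      simp only [DirectSum.coeAddMonoidHom_of]
      exact x.sum_single
  smul_mem' := by
    rintro i n r _ hr ⟨x, rfl⟩
    exact ⟨op r • x, (laurentAction_single 𝒜 I hr n x).symm⟩

/-- The homogeneous element of degree `n` given by an element of `I`. -/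
noncomputable def cofreeSingle (n : ℤ) : I →+ cofree 𝒜 I := Finsupp.singleAddHom n

variable {𝒜 I}

lemma cofreeSingle_injective (n : ℤ) : Function.Injective (cofreeSingle 𝒜 I n) :=
  Finsupp.single_injective n

lemma smul_cofreeSingle {i : ℕ} {r : R} (hr : r ∈ 𝒜 i) (n : ℤ) (x : I) :
    op r • cofreeSingle 𝒜 I n x = cofreeSingle 𝒜 I (n + i) (op r • x) :=
  laurentAction_single 𝒜 I hr n x

lemma mem_deg_cofree {n : ℤ} {x : cofree 𝒜 I} :
    x ∈ (cofree 𝒜 I).deg n ↔ ∃ y, cofreeSingle 𝒜 I n y = x := Iff.rfl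

lemma map_smul_of_homogeneous {M : GrMod 𝒜} {N : Type*} [AddCommGroup N] [Module Rᵐᵒᵖ N]
    (f : M →+ N)
    (h : ∀ (i : ℕ) (n : ℤ), ∀ r ∈ 𝒜 i, ∀ x ∈ M.deg n, f (op r • x) = op r • f x)
    (r : Rᵐᵒᵖ) (x : M) : f (r • x) = r • f x := by
  obtain ⟨r, rfl⟩ := op_surjective r
  induction r using Decomposition.inductionOn 𝒜 with
  | zero => simp
  | homogeneous s =>
    induction x using M.homogeneous_induction with
    | zero => simp
    | hom m x hx => exact h _ _ _ s.2 _ hx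
    | add x y hx hy => simp [hx, hy]
  | add r s hr hs => simp [add_smul, hr, hs]

variable (𝒜 I) in
/-- Evaluation of Laurent polynomials at one. -/
noncomputable def cofreeEval : cofree 𝒜 I →ₗ[Rᵐᵒᵖ] I where
  toFun := (Finsupp.liftAddHom fun _ => AddMonoidHom.id I : (ℤ →₀ I) →+ I)
  map_add' x y := map_add (Finsupp.liftAddHom fun _ => AddMonoidHom.id I : (ℤ →₀ I) →+ I) x y
  map_smul' := by
    refine map_smul_of_homogeneous (M := cofree 𝒜 I)
      (Finsupp.liftAddHom fun _ => AddMonoidHom.id I : (ℤ →₀ I) →+ I) ?_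
    rintro i n r hr _ ⟨x, rfl⟩
    have := smul_cofreeSingle hr n x
    refine (congrArg (Finsupp.liftAddHom fun _ => AddMonoidHom.id I : (ℤ →₀ I) →+ I) this).trans ?_
    refine (Finsupp.liftAddHom_apply_single _ _ _).trans ?_
    exact congrArg (fun y : I => op r • y)
      (Finsupp.liftAddHom_apply_single (fun _ : ℤ => AddMonoidHom.id I) n x).symm

lemma cofreeEval_single (n : ℤ) (x : I) : cofreeEval 𝒜 I (cofreeSingle 𝒜 I n x) = x :=
  Finsupp.liftAddHom_apply_single _ _ _

/-- The morphism to a cofree graded module corresponding to a linear map. -/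
noncomputable def cofreeLift {M : GrMod 𝒜} (h : M →ₗ[Rᵐᵒᵖ] I) : M ⟶ cofree 𝒜 I :=
  let F : M →+ cofree 𝒜 I := (DirectSum.toAddMonoid fun n =>
    ((cofreeSingle 𝒜 I n).comp h.toAddMonoidHom).comp (M.deg n).subtype).comp
      (DirectSum.decomposeAddEquiv M.deg).toAddMonoidHom
  have hF : ∀ n, ∀ x ∈ M.deg n, F x = cofreeSingle 𝒜 I n (h x) := fun n x hx => by
    have : decompose M.deg x = DirectSum.of (fun n => M.deg n) n ⟨x, hx⟩ := decompose_of_mem _ hx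
    change DirectSum.toAddMonoid _ (decompose M.deg x) = _
    rw [this, DirectSum.toAddMonoid_of]
    rfl
  { hom :=
      { toFun := F
        map_add' := map_add F
        map_smul' := map_smul_of_homogeneous F fun i n r hr x hx => by
          rw [hF _ _ hx, hF _ _ (M.smul_mem' _ _ _ _ hr hx), smul_cofreeSingle hr, map_smul] }
    map_deg := fun n x hx => ⟨h x, (hF n x hx).symm⟩ }

lemma cofreeLift_apply {M : GrMod 𝒜} (h : M →ₗ[Rᵐᵒᵖ] I) {n : ℤ} {x : M} (hx : x ∈ M.deg n) :
    (cofreeLift h).hom x = cofreeSingle 𝒜 I n (h x) := by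
  have : decompose M.deg x = DirectSum.of (fun n => M.deg n) n ⟨x, hx⟩ := decompose_of_mem _ hx
  change DirectSum.toAddMonoid _ (decompose M.deg x) = _
  rw [this, DirectSum.toAddMonoid_of]
  rfl

lemma injective_cofreeLift {M : GrMod 𝒜} {h : M →ₗ[Rᵐᵒᵖ] I} (hh : Function.Injective h) :
    Function.Injective (cofreeLift h).hom := by
  rw [← LinearMap.ker_eq_bot, eq_bot_iff]
  intro x hx
  refine eq_zero_of_comp fun n => ?_
  have : (cofreeLift h).hom (M.comp n x) = 0 := by
    rw [← comp_hom_apply, LinearMap.mem_ker.1 hx, map_zero]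
  rw [cofreeLift_apply h (M.comp_mem n x)] at this
  exact hh ((cofreeSingle_injective n (this.trans (map_zero _).symm)).trans (map_zero h).symm)

/-- The cofree construction is right adjoint to forgetting the grading, with counit `cofreeEval`.
Forgetting preserves monomorphisms, so its right adjoint preserves injectives. -/
lemma injective_cofree (hI : Module.Injective Rᵐᵒᵖ I) : Injective (cofree 𝒜 I) where
  factors {A B} f s _ := by
    obtain ⟨h, hh⟩ := hI.out s.hom (injective_of_mono s) (cofreeEval 𝒜 I ∘ₗ f.hom)
    refine ⟨cofreeLift h, ?_⟩
    ext1
    refine LinearMap.ext fun x => ?_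
    change (cofreeLift h).hom (s.hom x) = f.hom x
    induction x using A.homogeneous_induction with
    | zero => simp
    | hom n x hx =>
      rw [cofreeLift_apply h (s.map_deg n x hx), hh]
      obtain ⟨y, hy⟩ := mem_deg_cofree.1 (f.map_deg n x hx)
      rw [LinearMap.comp_apply, ← hy, cofreeEval_single]
    | add x y hx hy => simp [hx, hy]

end Cofree

variable [GradedAlgebra 𝒜] in
/-- Every graded module embeds into an injective one. -/
lemma exists_injective_embedding (M : GrMod 𝒜) :
    ∃ (J : GrMod 𝒜) (i : M ⟶ J), Injective J ∧ Function.Injective i.hom := by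
  obtain ⟨⟨I, hI, f, hf⟩⟩ := EnoughInjectives.presentation (ModuleCat.of Rᵐᵒᵖ M)
  have hI' : Module.Injective Rᵐᵒᵖ I := Module.injective_module_of_injective_object Rᵐᵒᵖ I
  exact ⟨cofree 𝒜 I, cofreeLift f.hom, injective_cofree hI',
    injective_cofreeLift ((ModuleCat.mono_iff_injective f).1 hf)⟩

/-! ### Injective hulls -/

/-- A morphism is an essential embedding if it is injective and its image meets every nonzero
homogeneous submodule nontrivially. -/
def IsEssentialEmbedding {U E : GrMod 𝒜} (i : U ⟶ E) : Prop :=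
  Function.Injective i.hom ∧ ∀ A : Submodule Rᵐᵒᵖ E, A.IsHomogeneous E.deg → A ≠ ⊥ →
    ∃ x, x ≠ 0 ∧ i.hom x ∈ A

/-- A nonzero kernel of `g` would meet the image of `i`. -/
lemma IsEssentialEmbedding.injective {U E F : GrMod 𝒜} {i : U ⟶ E} (hi : IsEssentialEmbedding i)
    (g : E ⟶ F) (hg : Function.Injective (i ≫ g).hom) : Function.Injective g.hom := by
  rw [← LinearMap.ker_eq_bot]
  by_contra h
  obtain ⟨x, hx, hxg⟩ := hi.2 _ (isHomogeneous_ker g) h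
  exact hx (hg (hxg.trans (map_zero (i ≫ g).hom).symm))

variable [GradedAlgebra 𝒜] in
/-- Every graded module has an injective hull. -/
lemma exists_injective_hull (U : GrMod 𝒜) :
    ∃ (E : GrMod 𝒜) (i : U ⟶ E), Injective E ∧ IsEssentialEmbedding i := by
  obtain ⟨J, i, hJ, hi⟩ := U.exists_injective_embedding
  -- The hull will be `J / C`: maximality of `C` makes `U ⟶ J / C` essential. The complement `V` of
  -- `C` serves to show that `J / C` is a retract of `J`.
  obtain ⟨C, -, hC⟩ := exists_maximal_disjoint (LinearMap.range i.hom) ⊥ (isHomogeneous_bot J)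
    (bot_inf_eq _)
  obtain ⟨V, hiV, hV⟩ := exists_maximal_disjoint C (LinearMap.range i.hom) (isHomogeneous_range i)
    (by rw [inf_comm]; exact hC.prop.2)
  let q := J.quotπ C hC.prop.1
  have hqker : LinearMap.ker q.hom = C := Submodule.ker_mkQ C
  have hess : IsEssentialEmbedding (i ≫ q) := by
    refine ⟨?_, fun A hA hne => ?_⟩
    · rw [← LinearMap.ker_eq_bot, eq_bot_iff]
      intro x hx
      have h0 : i.hom x ∈ C ⊓ LinearMap.range i.hom := ⟨quotπ_apply_eq_zero.1 hx, x, rfl⟩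
      rw [hC.prop.2] at h0
      exact hi (h0.trans (map_zero i.hom).symm)
    · have hle : C ≤ A.comap q.hom := hqker.symm.le.trans (Submodule.comap_mono bot_le)
      have hnot : A.comap q.hom ⊓ LinearMap.range i.hom ≠ ⊥ := fun h => hne <| by
        rw [eq_bot_iff]
        intro y hy
        obtain ⟨y, rfl⟩ := quotπ_surjective _ _ hC.prop.1 y
        exact quotπ_apply_eq_zero.2 (hC.le_of_ge ⟨isHomogeneous_comap q hA, h⟩ hle hy)
      obtain ⟨_, ⟨hyA, x, rfl⟩, hy0⟩ := Submodule.exists_mem_ne_zero_of_ne_bot hnot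
      exact ⟨x, fun h => hy0 (by rw [h, map_zero]), hyA⟩
  refine ⟨J.quot C hC.prop.1, i ≫ q, ?_, hess⟩
  let ι := J.subι V hV.prop.1
  obtain ⟨g, hg⟩ : ∃ g : J.quot C hC.prop.1 ⟶ J, (ι ≫ q) ≫ g = ι := by
    refine exists_extension _ _ fun x hx => ?_
    have h0 : ι.hom x ∈ V ⊓ C := ⟨Subtype.property (p := (· ∈ V)) x, quotπ_apply_eq_zero.1 hx⟩
    exact hV.prop.2.le h0
  have hgV : ∀ x ∈ V, g.hom (q.hom x) = x := fun x hx =>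
    congrArg (fun k : J.sub V hV.prop.1 ⟶ J => k.hom ⟨x, hx⟩) hg
  have hgi : (i ≫ q) ≫ g = i := by
    ext1
    exact LinearMap.ext fun x => hgV _ (hiV ⟨x, rfl⟩)
  have hginj : Function.Injective g.hom := hess.injective g (by rwa [hgi])
  -- The range of `g` contains `V` and, by essentiality, still meets `C` trivially, so maximality of
  -- `V` gives equality.
  have hrange : LinearMap.range g.hom ≤ V := by
    refine hV.le_of_ge ⟨isHomogeneous_range g, ?_⟩ fun x hx => ⟨q.hom x, hgV x hx⟩
    have hcomap : C.comap g.hom = ⊥ := by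
      by_contra h
      obtain ⟨x, hx, hxC⟩ := hess.2 _ (isHomogeneous_comap g hC.prop.1) h
      have h0 : i.hom x ∈ C ⊓ LinearMap.range i.hom := by
        refine ⟨?_, x, rfl⟩
        conv => rw [← hgi]
        exact hxC
      rw [hC.prop.2] at h0
      exact hx (hi (h0.trans (map_zero i.hom).symm))
    rw [eq_bot_iff]
    rintro _ ⟨⟨e, rfl⟩, he⟩
    have : e ∈ C.comap g.hom := he
    rw [hcomap] at this
    rw [(Submodule.mem_bot _).1 this, map_zero]
    exact Submodule.zero_mem _
  refine Retract.injective (Y := J) ⟨g, q, ?_⟩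
  ext1
  exact LinearMap.ext fun e => hginj (hgV _ (hrange ⟨e, rfl⟩))

variable [GradedAlgebra 𝒜] in
-- A nonzero torsion submodule of `E` would meet the image of `U`.
lemma IsEssentialEmbedding.isTorsionFree {U E : GrMod 𝒜} {i : U ⟶ E}
    (hi : IsEssentialEmbedding i) (hU : U.IsTorsionFree) : E.IsTorsionFree := by
  intro y hy
  by_contra hy0
  obtain ⟨x, hx, hxt⟩ := hi.2 (torsionModulo ⊥) (isHomogeneous_torsionModulo (isHomogeneous_bot E))
    fun h => hy0 ((Submodule.eq_bot_iff _).1 h y hy)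
  refine hx (hU x ?_)
  rw [← LinearMap.ker_eq_bot.2 hi.1, isTorsionModulo_ker_iff]
  exact hxt

lemma IsEssentialEmbedding.isUniform {U E : GrMod 𝒜} {i : U ⟶ E}
    (hi : IsEssentialEmbedding i) (hU : U.IsUniform) : E.IsUniform := by
  have key : ∀ A : Submodule Rᵐᵒᵖ E, A.IsHomogeneous E.deg → A ≠ ⊥ → A.comap i.hom ≠ ⊥ :=
    fun A hA hA0 h => by
      obtain ⟨x, hx, hxA⟩ := hi.2 A hA hA0
      exact hx ((Submodule.eq_bot_iff _).1 h x hxA)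
  intro A B hA hB hA0 hB0 h
  apply hU _ _ (isHomogeneous_comap i hA) (isHomogeneous_comap i hB) (key A hA hA0) (key B hB hB0)
  rw [← Submodule.comap_inf, h]
  exact LinearMap.ker_eq_bot.2 hi.1

/-- A nonzero uniform graded module is indecomposable. -/
lemma IsUniform.indecomposable {E : GrMod 𝒜} (hE : E.IsUniform) (h0 : ¬ IsZero E) :
    Indecomposable E := by
  refine ⟨h0, fun Y Z e => ?_⟩
  by_contra! hcon
  have hne : ∀ {Y : GrMod 𝒜} (f : Y ⟶ E) [Mono f], ¬ IsZero Y → LinearMap.range f.hom ≠ ⊥ := by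
    intro Y f _ hY h
    apply hY
    rw [LinearMap.range_eq_bot] at h
    rw [IsZero.iff_id_eq_zero, ← cancel_mono f]
    ext1
    simp [h]
  let a : Y ⟶ E := biprod.inl ≫ e.inv
  let b : Z ⟶ E := biprod.inr ≫ e.inv
  have : Mono a := mono_comp _ _
  have : Mono b := mono_comp _ _
  -- Two nonzero summands have nonzero images in `E`. Projecting to `Y` shows that these images are
  -- disjoint.
  refine hE _ _ (isHomogeneous_range a) (isHomogeneous_range b) (hne a hcon.1) (hne b hcon.2) ?_
  rw [eq_bot_iff]
  rintro _ ⟨⟨y, rfl⟩, ⟨z, hz⟩⟩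
  have h1 : a ≫ e.hom ≫ biprod.fst = 𝟙 Y := by simp [a]
  have h2 : b ≫ e.hom ≫ biprod.fst = 0 := by simp [b]
  have h3 : y = 0 := by
    have e1 := congrArg (fun k : Y ⟶ Y => k.hom y) h1
    have e2 := congrArg (fun k : Z ⟶ Y => k.hom z) h2
    have e3 := congrArg (e.hom ≫ biprod.fst).hom hz
    exact (e1.symm.trans e3.symm).trans e2
  rw [h3, map_zero]
  exact Submodule.zero_mem _

/-! ### The quotient category -/

/-- A torsion-free injective graded module is local with respect to the morphisms with torsion
kernel and cokernel. -/
lemma bijective_comp_of_isoModTorsion {E : GrMod 𝒜} [Injective E] (hE : E.IsTorsionFree)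
    {A B : GrMod 𝒜} (s : A ⟶ B) (hs : isoModTorsion 𝒜 s) :
    Function.Bijective fun g : B ⟶ E => s ≫ g := by
  have htf : ∀ {M : GrMod 𝒜} (f : M ⟶ E) (x : M), IsTorsionModulo (LinearMap.ker f.hom) x →
      f.hom x = 0 := fun f x hx => hE _ ((isTorsionModulo_ker_iff f x).1 hx)
  refine ⟨fun g g' h => ?_, fun f => ?_⟩
  -- The difference `g - g'` kills the range of `s`. As the cokernel of `s` is torsion, its values
  -- are torsion elements of `E`, hence zero.
  · rw [← sub_eq_zero]
    have h0 : s ≫ (g - g') = 0 := by rw [Preadditive.comp_sub, sub_eq_zero]; exact h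
    ext1
    refine LinearMap.ext fun y => htf _ _ ((hs.2 y).mono ?_)
    rintro _ ⟨x, rfl⟩
    exact congrArg (fun k : A ⟶ E => k.hom x) h0
  · exact exists_extension s f fun x hx => htf f x ((hs.1 x hx).mono bot_le)

/-- The projection to the quotient category is faithful on morphisms to torsion-free injective
graded modules. -/
lemma eq_of_π_map_eq {E : GrMod 𝒜} [Injective E] (hE : E.IsTorsionFree) {M : GrMod 𝒜}
    {f g : M ⟶ E} (h : (Tails.π 𝒜).map f = (Tails.π 𝒜).map g) : f = g := by
  -- `Hom(-, E)`, made covariant, extends to the localization. Evaluating its extension at `π f = π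
  -- g` on `𝟙 E` recovers `f = g`.
  let G : GrMod 𝒜 ⥤ (Type u)ᵒᵖ := (yoneda.obj E).rightOp
  have hG : (isoModTorsion 𝒜).IsInvertedBy G := fun A B s hs => by
    have : IsIso ((yoneda.obj E).map s.op) :=
      (isIso_iff_bijective _).2 (bijective_comp_of_isoModTorsion hE s hs)
    exact inferInstanceAs (IsIso ((yoneda.obj E).map s.op).op)
  have key : G.map f = G.map g := by
    have := congrArg (Localization.Construction.lift G hG).map h
    exact this
  have := ConcreteCategory.congr_hom (congrArg Quiver.Hom.unop key) (𝟙 E)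
  simpa [G] using this

/-- The projection to the quotient category kills torsion modules. -/
lemma isZero_π_obj {M : GrMod 𝒜} (hM : ∀ x : M, IsTorsionModulo (⊥ : Submodule Rᵐᵒᵖ M) x) :
    IsZero ((Tails.π 𝒜).obj M) := by
  have hid : (Tails.π 𝒜).map (0 : M ⟶ M) = 𝟙 _ := by
    have hs : isoModTorsion 𝒜 (0 : M ⟶ M) :=
      ⟨fun x _ => hM x, fun y => (hM y).mono bot_le⟩
    have : IsIso ((Tails.π 𝒜).map (0 : M ⟶ M)) := Localization.inverts _ (isoModTorsion 𝒜) _ hs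
    -- An idempotent isomorphism is the identity.
    rw [← cancel_epi ((Tails.π 𝒜).map (0 : M ⟶ M)), ← Functor.map_comp]
    simp
  -- The images of the zero maps to and from `M` extend to natural transformations between the
  -- identity and the constant functor at `πM`. Both are the identity at `πM`, so naturality
  -- determines every morphism into or out of `πM`.
  let c : Tails 𝒜 ⥤ Tails 𝒜 := (Functor.const _).obj ((Tails.π 𝒜).obj M)
  let τ : 𝟭 (Tails 𝒜) ⟶ c := Localization.Construction.natTransExtension
    { app := fun Y => (Tails.π 𝒜).map (0 : Y ⟶ M)
      naturality := fun Y Z f => by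
        change (Tails.π 𝒜).map f ≫ (Tails.π 𝒜).map 0 = (Tails.π 𝒜).map 0 ≫ 𝟙 _
        rw [← Functor.map_comp]; simp }
  let σ : c ⟶ 𝟭 (Tails 𝒜) := Localization.Construction.natTransExtension
    { app := fun Y => (Tails.π 𝒜).map (0 : M ⟶ Y)
      naturality := fun Y Z f => by
        change 𝟙 _ ≫ (Tails.π 𝒜).map 0 = (Tails.π 𝒜).map 0 ≫ (Tails.π 𝒜).map f
        rw [← Functor.map_comp]; simp }
  have hτ : τ.app ((Tails.π 𝒜).obj M) = 𝟙 _ :=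
    (Localization.Construction.NatTransExtension.app_eq _ M).trans hid
  have hσ : σ.app ((Tails.π 𝒜).obj M) = 𝟙 _ :=
    (Localization.Construction.NatTransExtension.app_eq _ M).trans hid
  have h1 : ∀ {Y : Tails 𝒜} (f : Y ⟶ (Tails.π 𝒜).obj M), f = τ.app Y := fun {Y} f => by
    have := τ.naturality f
    rw [hτ] at this
    simpa [c] using this
  have h2 : ∀ {Y : Tails 𝒜} (f : (Tails.π 𝒜).obj M ⟶ Y), f = σ.app Y := fun {Y} f => by
    have := σ.naturality f
    rw [hσ] at this
    simpa [c] using this.symm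
  exact ⟨fun Y => ⟨⟨⟨σ.app Y⟩, h2⟩⟩, fun Y => ⟨⟨⟨τ.app Y⟩, h1⟩⟩⟩

/-! ### Torsion-free indecomposable injectives detect nontorsion modules -/

variable [GradedAlgebra 𝒜]

/-- The assassinator of a torsion-free graded module is not the irrelevant ideal. -/
lemma IsAssassinator.ne_irrelevantIdeal {E : GrMod 𝒜} (hE : E.IsTorsionFree) {P : TwoSidedIdeal R}
    (hP : E.IsAssassinator P) : P ≠ irrelevantIdeal 𝒜 := by
  obtain ⟨N, -, hN0, rfl⟩ := hP.2.prop
  intro h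
  refine hN0 ((Submodule.eq_bot_iff _).2 fun x hx => hE x ⟨0, fun j hj r hr => ?_⟩)
  have : r ∈ irrelevantIdeal 𝒜 := by
    rw [irrelevantIdeal, TwoSidedIdeal.mem_ker, GradedRing.projZeroRingHom_apply,
      decompose_of_mem_ne 𝒜 hr hj.ne']
  rw [← h] at this
  exact (Submodule.mem_bot _).2 (mem_annihilator.1 this x hx)

/-- A graded module which is not torsion has a nonzero morphism to a torsion-free indecomposable
injective graded module. -/
lemma exists_hom_indecomposable_injective (hnoeth : IsNoetherianRing Rᵐᵒᵖ) {M : GrMod 𝒜} {x : M}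
    (hx : ¬ IsTorsionModulo (⊥ : Submodule Rᵐᵒᵖ M) x) :
    ∃ (E : GrMod 𝒜) (f : M ⟶ E), f ≠ 0 ∧ Injective E ∧ Indecomposable E ∧ E.IsTorsionFree := by
  obtain ⟨U, f, hf, hUt, hUu⟩ := exists_uniform_torsionFree_quotient hnoeth hx
  obtain ⟨E, i, hE, hi⟩ := exists_injective_hull U
  have : Mono i := mono_of_injective i hi.1
  have hfi : f ≫ i ≠ 0 := fun h => hf (by rwa [← cancel_mono i, zero_comp])
  exact ⟨E, f ≫ i, hfi, hE, (hi.isUniform hUu).indecomposable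
    fun h => hfi (h.eq_of_tgt _ _), hi.isTorsionFree hUt⟩

end GrMod

theorem mainTheorem4 {K : Type v} {R : Type u} [Field K] [Ring R] [Algebra K R]
    (𝒜 : ℕ → Submodule K R) [GradedAlgebra 𝒜]
    (hconn : IsConnectedGraded 𝒜) (hgen : IsGeneratedInDegreeOne 𝒜)
    (hnoeth : IsNoetherianRing Rᵐᵒᵖ) (hbdd : IsRightFullyBounded R) :
    ∀ X : Tails 𝒜, (∀ T ∈ Tails.injectiveTorsionClasses 𝒜, T X) ↔ IsZero X := by
  intro X
  constructor
  · intro h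
    obtain ⟨M, rfl⟩ := (Localization.Construction.objEquiv (GrMod.isoModTorsion 𝒜)).surjective X
    refine GrMod.isZero_π_obj fun x => ?_
    by_contra hx
    obtain ⟨E, f, hf, hE, hind, htf⟩ := GrMod.exists_hom_indecomposable_injective hnoeth hx
    have hnt : Nontrivial E := by
      rw [← not_subsingleton_iff_nontrivial, ← GrMod.isZero_iff_subsingleton]
      exact hind.1
    obtain ⟨P, hP⟩ := GrMod.exists_isAssassinator hnoeth hnt
    have : Subsingleton ((Tails.π 𝒜).obj M ⟶ (Tails.π 𝒜).obj E) :=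
      h _ ⟨E, hE, hind, ⟨P, hP, hP.ne_irrelevantIdeal htf⟩, rfl⟩
    -- Uniqueness of morphisms `πM ⟶ πE` identifies `π f` with `π 0`.
    exact hf (GrMod.eq_of_π_map_eq htf (Subsingleton.elim _ _))
  · rintro h T ⟨E, -, -, -, rfl⟩
    exact ⟨fun f g => h.eq_of_src f g⟩
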